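/- For real polynomials $p_s$ ($s\in I$, $I$ finite) and $r$ in variables $x_1,\dots,x_n$, an SoS certificate of non-negativity of $r$ from the equations $p_s=0$ is a polynomial identity $r=\sum_{i=1}^t h_i^2+\sum_{s\in I}\lambda_s p_s$ with real polynomials $h_i,\lambda_s$. It has degree at most $d$ if $\deg h_i^2\le d$ and $\deg(\lambda_s p_s)\le d$ for all $i,s$. Its coefficients are the coefficients, in the monomial basis, of the polynomials $h_i$ and $\lambda_s$. For integers $m,k\ge 1$ with $2km\le n$ put $y_i=\sum_{j=1}^{2k}x_{2k(i-1)+j}-k$ for $1\le i\le m$, and let $\mathcal P_{n,m,k}$ be the system of equations $$x_j^2-x_j=0\ (1\le j\le n),\qquad y_i^2-y_{i+1}=0\ (1\le i\le m-1),\qquad y_m^2=0 .$$ **Theorem.** There are absolute constants $\varepsilon\in(0,\tfrac12)$, $c>0$ and $A$ such that for every $n\ge 2$ there are integers $m,k\ge1$ with $2km\le n$ for which the system $\mathcal P=\mathcal P_{n,m,k}$ in $n$ variables and the polynomial $r=\varepsilon-y_1$ satisfy: 1. every polynomial in $\mathcal P$ has degree $2$, and $\mathcal P$ contains $x_j^2-x_j$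 for every $j\in\{1,\dots,n\}$; 2. $r$ has an SoS certificate of non-negativity from $\mathcal P$ of degree at most $2$, all of whose coefficients are at most $2^{2^{A\sqrt n}}$ in absolute value; 3. for every integer $0\le d\le\sqrt n$, every SoS certificate of non-negativity of $r$ from $\mathcal P$ of degree at most $d$ has a coefficient, in one of the multipliers $\lambda_s$, of absolute value at least $$c\cdot\frac{2^{2^{\sqrt n}}}{n^d}.$$ -/

import Mathlib

open MvPolynomial

/-- A Sum-of-Squares certificate of non-negativity of `r` from the finite system of equations
`P s = 0` (`s : ι`): a polynomial identity `r = ∑ hᵢ² + ∑ₛ λₛ Pₛ`. -/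
structure SoSCertificate {σ ι : Type*} [Fintype ι] (P : ι → MvPolynomial σ ℝ)
    (r : MvPolynomial σ ℝ) where
  /-- the number of squares -/
  t : ℕ
  /-- the polynomials that are squared -/
  h : Fin t → MvPolynomial σ ℝ
  /-- the multipliers `λₛ` of the equations -/
  mult : ι → MvPolynomial σ ℝ
  identity : r = ∑ i, h i ^ 2 + ∑ s, mult s * P s

/-- Every term `hᵢ²` and `λₛ Pₛ` of the certificate has degree at most `d`. -/
def SoSCertificate.DegreeLE {σ ι : Type*} [Fintype ι] {P : ι → MvPolynomial σ ℝ}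
    {r : MvPolynomial σ ℝ} (c : SoSCertificate P r) (d : ℕ) : Prop :=
  (∀ i, (c.h i ^ 2).totalDegree ≤ d) ∧ ∀ s, (c.mult s * P s).totalDegree ≤ d

/-- Every coefficient of every polynomial `hᵢ` and `λₛ` of the certificate is at most `B`
in absolute value. -/
def SoSCertificate.CoeffLE {σ ι : Type*} [Fintype ι] {P : ι → MvPolynomial σ ℝ}
    {r : MvPolynomial σ ℝ} (c : SoSCertificate P r) (B : ℝ) : Prop :=
  (∀ i M, |coeff M (c.h i)| ≤ B) ∧ ∀ s M, |coeff M (c.mult s)| ≤ B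

/-- The linear form `(∑_{j in block i} x_j) - k`, where block `i` (counted from `0`) consists of the
`2k` consecutive variables `x_{2ki}, …, x_{2ki + 2k - 1}`. -/
noncomputable def blockForm (n k i : ℕ) : MvPolynomial (Fin n) ℝ :=
  (∑ j : Fin n with j.val / (2 * k) = i, X j) - C (k : ℝ)

/-- The Boolean repeated-squaring system in `n` variables: with `yᵢ = blockForm n k i`, it consists
of `x_j² - x_j` for every variable, `yᵢ² - yᵢ₊₁` for `0 ≤ i < m - 1`, and `yₘ₋₁²`. -/
noncomputable def squaringSystem (n m k : ℕ) : Fin n ⊕ Fin m → MvPolynomial (Fin n) ℝ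
  | Sum.inl j => X j ^ 2 - X j
  | Sum.inr i =>
      if i.val + 1 < m then blockForm n k i.val ^ 2 - blockForm n k (i.val + 1)
      else blockForm n k i.val ^ 2

/-! Blocks are counted from 0, as in the code. Upper bound: eliminate `y₀, y₁, …` in turn by
completing squares. Each elimination squares the coefficient up to a factor `8m`, so the
coefficients grow doubly exponentially while the degree stays 2 (`squaringCertificate`).

Lower bound: apply to a certificate a linear functional `E` that treats block `i` as if its `2k`
Boolean variables had the sum `k + δ ^ 2 ^ i`. No Boolean point has such sums, but the knapsack
pseudo-expectation does, and it is nonnegative on squares up to degree `2k`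
(`knapsackMatrix_form_nonneg`). By the Schur product theorem the product over the blocks stays
nonnegative on squares (`pseudoExp_sq_nonneg`). In the available degree `E` kills every equation
term except the last, on which it gives `E (λ y²) = δ ^ 2 ^ m * E λ`. As `E y₀ = δ > ε`, the
identity forces `|E λ| ≥ (δ - ε) / δ ^ 2 ^ m`. All moments are at most 1 in absolute value
(`abs_knapsackMoment_le_one`), so `|E λ|` is at most the number of monomials times the largest
coefficient of `λ`. -/

/-! ### Moments of the knapsack pseudo-expectation -/

/-- The value `r(r-1)⋯(r-a+1) · (N-r)⋯(N-r-b+1) / (N⋯(N-a-b+1))` which the knapsack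
pseudo-expectation in `N` Boolean variables of sum `r` gives to a product of `a` variables
and `b` complements `1 - x` of further variables. -/
noncomputable def knapsackMoment (N : ℕ) (r : ℝ) (a b : ℕ) : ℝ :=
  (∏ l ∈ Finset.range a, (r - l)) * (∏ l ∈ Finset.range b, (N - r - l)) /
    ∏ l ∈ Finset.range (a + b), ((N : ℝ) - l)

theorem knapsackMoment_zero_zero (N : ℕ) (r : ℝ) : knapsackMoment N r 0 0 = 1 := by
  simp [knapsackMoment]

theorem prod_range_natCast_sub_pos {N s : ℕ} (h : s ≤ N) :
    0 < ∏ l ∈ Finset.range s, ((N : ℝ) - l) := by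
  refine Finset.prod_pos fun l hl => ?_
  have : l < N := (Finset.mem_range.1 hl).trans_le h
  have : (l : ℝ) < N := by exact_mod_cast this
  linarith

theorem knapsackMoment_succ_left {N : ℕ} (r : ℝ) {s : ℕ} (h : s < N) :
    (N - s : ℝ) * knapsackMoment N r (s + 1) 0 = (r - s) * knapsackMoment N r s 0 := by
  have h1 := (prod_range_natCast_sub_pos h.le).ne'
  have h2 : (N : ℝ) - s ≠ 0 := sub_ne_zero.2 (by exact_mod_cast h.ne')
  simp only [knapsackMoment, add_zero, Finset.prod_range_succ, Finset.prod_range_zero]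
  field_simp

/-- This is `1 = x + (1 - x)` for one further variable `x`. -/
theorem knapsackMoment_split {N : ℕ} (r : ℝ) {a b : ℕ} (h : a + b < N) :
    knapsackMoment N r a b = knapsackMoment N r (a + 1) b + knapsackMoment N r a (b + 1) := by
  have h1 := (prod_range_natCast_sub_pos h.le).ne'
  have h2 : (N : ℝ) - (a + b : ℕ) ≠ 0 := sub_ne_zero.2 (by exact_mod_cast h.ne')
  have e1 : a + 1 + b = a + b + 1 := by ring
  have e2 : a + (b + 1) = a + b + 1 := by ring
  simp only [knapsackMoment, e1, e2, Finset.prod_range_succ]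
  field_simp
  push_cast
  ring

/-- Expansion of `∏ (x + (1 - x)) = 1` over the variables of `U`; `J` collects the complemented
ones. -/
theorem knapsackMoment_eq_sum_powerset {α : Type*} [DecidableEq α] {N : ℕ} (r : ℝ) (U : Finset α) :
    ∀ a b : ℕ, a + U.card + b ≤ N → knapsackMoment N r a b =
      ∑ J ∈ U.powerset, knapsackMoment N r (a + U.card - J.card) (b + J.card) := by
  induction U using Finset.induction_on with
  | empty => intro a b _; simp
  | insert x U hx ih =>
    intro a b h
    rw [Finset.card_insert_of_notMem hx] at h ⊢
    rw [Finset.sum_powerset_insert hx, knapsackMoment_split r (by omega),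
      ih (a + 1) b (by omega), ih a (b + 1) (by omega)]
    congr 1
    · refine Finset.sum_congr rfl fun J _ => ?_
      congr 1; omega
    · refine Finset.sum_congr rfl fun J hJ => ?_
      have hJ' : x ∉ J := fun hxJ => hx (Finset.mem_powerset.1 hJ hxJ)
      have := Finset.card_le_card (Finset.mem_powerset.1 hJ)
      rw [Finset.card_insert_of_notMem hJ']
      congr 1 <;> omega

/-- The moments satisfy the knapsack equation `∑ x_j = r`. -/
theorem sum_knapsackMoment_insert {α : Type*} [DecidableEq α] (r : ℝ) {B U : Finset α}
    (hU : U ⊂ B) :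
    ∑ j ∈ B, knapsackMoment B.card r (insert j U).card 0 =
      r * knapsackMoment B.card r U.card 0 := by
  have hlt := Finset.card_lt_card hU
  rw [← Finset.sum_sdiff hU.1]
  have h1 : ∀ j ∈ B \ U, knapsackMoment B.card r (insert j U).card 0 =
      knapsackMoment B.card r (U.card + 1) 0 := fun j hj => by
    rw [Finset.card_insert_of_notMem (Finset.mem_sdiff.1 hj).2]
  have h2 : ∀ j ∈ U, knapsackMoment B.card r (insert j U).card 0 =
      knapsackMoment B.card r U.card 0 := fun j hj => by
    rw [Finset.insert_eq_of_mem hj]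
  rw [Finset.sum_congr rfl h1, Finset.sum_congr rfl h2, Finset.sum_const, Finset.sum_const,
    Finset.card_sdiff_of_subset hU.1, nsmul_eq_mul, nsmul_eq_mul, Nat.cast_sub hlt.le,
    knapsackMoment_succ_left r hlt]
  ring

/-! ### Positivity of the knapsack moment matrix -/

/-- Normal equations: every vector has a least-squares approximation by given vectors. -/
theorem exists_normal_equations {ι X : Type*} [Fintype ι] [Fintype X] (u : ι → X → ℝ)
    (t : X → ℝ) : ∃ g : ι → ℝ, ∀ i, ∑ x, u i x * (t x - ∑ j, g j * u j x) = 0 := by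
  let v : ι → EuclideanSpace ℝ X := fun i => WithLp.toLp 2 (u i)
  obtain ⟨y, hy, z, hz, htz⟩ :=
    (Submodule.span ℝ (Set.range v)).exists_add_mem_mem_orthogonal (WithLp.toLp 2 t)
  obtain ⟨g, rfl⟩ := (Submodule.mem_span_range_iff_exists_fun ℝ).1 hy
  refine ⟨g, fun i => ?_⟩
  have hzi := (Submodule.mem_orthogonal _ _).1 hz (v i) (Submodule.subset_span ⟨i, rfl⟩)
  rw [← hzi, PiLp.inner_apply]
  refine Finset.sum_congr rfl fun x _ => ?_
  have hx : t x = (∑ j, g j • v j : EuclideanSpace ℝ X) x + z x := by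
    rw [← PiLp.add_apply, ← htz]
  have hs : (∑ j, g j • v j : EuclideanSpace ℝ X) x = ∑ j, g j * u j x := by
    simp [v, WithLp.ofLp_sum, Finset.sum_apply]
  rw [hx, hs]
  simp [v, mul_comm]

section Knapsack

open Matrix

variable {α : Type*} [Fintype α] [DecidableEq α]

/-- The moment matrix of the knapsack pseudo-expectation. -/
noncomputable def knapsackMatrix (α : Type*) [Fintype α] [DecidableEq α] (r : ℝ) :
    Matrix (Finset α) (Finset α) ℝ :=
  fun S T => knapsackMoment (Fintype.card α) r (S ∪ T).card 0

theorem knapsackMatrix_comm (r : ℝ) (S T : Finset α) :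
    knapsackMatrix α r S T = knapsackMatrix α r T S := by
  simp only [knapsackMatrix, Finset.union_comm]

/-- The indicator of the sets that arise from `J` by adding one element. -/
def coverIndicator (J S : Finset α) : ℝ := if J ⊆ S ∧ S.card = J.card + 1 then 1 else 0

theorem sum_coverIndicator_mul (J : Finset α) (F : Finset α → ℝ) :
    ∑ S, coverIndicator J S * F S = ∑ j ∈ Jᶜ, F (insert j J) := by
  simp only [coverIndicator, ite_mul, one_mul, zero_mul]
  rw [← Finset.sum_filter]
  symm
  refine Finset.sum_bij (fun j _ => insert j J) ?_ ?_ ?_ ?_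
  · intro j hj
    rw [Finset.mem_compl] at hj
    simp [Finset.card_insert_of_notMem hj]
  · intro a ha b hb hab
    rw [Finset.mem_compl] at ha hb
    exact (Finset.insert_inj ha).1 hab
  · intro S hS
    obtain ⟨hJS, hc⟩ := (Finset.mem_filter.1 hS).2
    have h1 : (S \ J).card = 1 := by rw [Finset.card_sdiff_of_subset hJS]; omega
    obtain ⟨x, hx⟩ := Finset.card_eq_one.1 h1
    have hxm : x ∈ S \ J := by rw [hx]; simp
    refine ⟨x, by simpa using (Finset.mem_sdiff.1 hxm).2, ?_⟩
    rw [← Finset.sdiff_union_of_subset hJS, hx, Finset.insert_eq]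
  · intros; rfl

/-- Multiply `∑ x_j = r` by the monomial of `J`: the terms with `j ∈ J` reproduce that monomial,
since `x_j ^ 2 = x_j`. A star of `J` can thus be traded for a multiple of `J`, one degree lower. -/
theorem sum_coverIndicator_mul_knapsackMatrix (r : ℝ) {J T : Finset α}
    (h : (J ∪ T).card < Fintype.card α) :
    ∑ S, coverIndicator J S * knapsackMatrix α r S T =
      (r - J.card) * knapsackMatrix α r J T := by
  rw [sum_coverIndicator_mul]
  have h0 := sum_knapsackMoment_insert r (B := Finset.univ) (U := J ∪ T)
    ((Finset.ssubset_univ_iff).2 fun hu => by rw [hu, Finset.card_univ] at h; exact h.ne rfl)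
  rw [Finset.card_univ, ← Finset.sum_compl_add_sum J] at h0
  have h2 : ∑ j ∈ J, knapsackMoment (Fintype.card α) r (insert j (J ∪ T)).card 0 =
      J.card * knapsackMatrix α r J T := by
    rw [← nsmul_eq_mul, ← Finset.sum_const]
    refine Finset.sum_congr rfl fun j hj => ?_
    rw [Finset.insert_eq_of_mem (Finset.mem_union_left _ hj), knapsackMatrix]
  rw [h2] at h0
  simp only [knapsackMatrix, Finset.insert_union] at h0 ⊢
  linarith

/-- A function on the `D`-sets which is orthogonal to all stars of `(D-1)`-sets
is orthogonal to all stars of smaller sets. -/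
theorem sum_superset_eq_zero {q : Finset α → ℝ} {D : ℕ} (hq : ∀ S, S.card ≠ D → q S = 0)
    (horth : ∀ J : Finset α, J.card + 1 = D → ∑ S, coverIndicator J S * q S = 0) :
    ∀ e : ℕ, ∀ J : Finset α, J.card + (e + 1) = D → ∑ S with J ⊆ S, q S = 0 := by
  intro e
  induction e with
  | zero =>
    intro J hJ
    rw [← horth J hJ, Finset.sum_filter]
    refine Finset.sum_congr rfl fun S _ => ?_
    by_cases hS : S.card = D
    · simp [coverIndicator, hS, hJ.symm]
    · simp [hq S hS]
  | succ e ih =>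
    intro J hJ
    have h1 : ∑ j ∈ Jᶜ, ∑ S with insert j J ⊆ S, q S = 0 := by
      refine Finset.sum_eq_zero fun j hj => ih _ ?_
      rw [Finset.card_insert_of_notMem (by simpa using hj)]
      omega
    -- Double counting: a `D`-set containing `J` contains `insert j J` for exactly `D - |J| = e + 2`
    -- elements `j` outside `J`.
    have h2 : ∑ j ∈ Jᶜ, ∑ S with insert j J ⊆ S, q S =
        ((e + 2 : ℕ) : ℝ) * ∑ S with J ⊆ S, q S := by
      simp only [Finset.sum_filter]
      rw [Finset.sum_comm, Finset.mul_sum]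
      refine Finset.sum_congr rfl fun S _ => ?_
      by_cases hS : S.card = D
      · by_cases hJS : J ⊆ S
        · have : Jᶜ.filter (fun j => insert j J ⊆ S) = S \ J := by
            ext j
            simp only [Finset.mem_filter, Finset.mem_compl, Finset.mem_sdiff,
              Finset.insert_subset_iff]
            tauto
          rw [← Finset.sum_filter, this, Finset.sum_const, Finset.card_sdiff_of_subset hJS,
            if_pos hJS, nsmul_eq_mul]
          congr 2
          omega
        · rw [if_neg hJS, mul_zero]
          refine Finset.sum_eq_zero fun j _ => if_neg fun h => hJS ?_
          exact (Finset.subset_insert j J).trans h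
      · simp [hq S hS]
    rw [h1] at h2
    rcases mul_eq_zero.1 h2.symm with h | h
    · exact absurd h (by positivity)
    · exact h

/-- Harmonic functions on `D`-sets are eigenvectors of the moment matrix. -/
theorem sum_mul_knapsackMatrix_of_harmonic (r : ℝ) {q : Finset α → ℝ} {D : ℕ}
    (hD : 2 * D ≤ Fintype.card α) (hq : ∀ S, S.card ≠ D → q S = 0)
    (horth : ∀ J : Finset α, J.card + 1 = D → ∑ S, coverIndicator J S * q S = 0)
    {T : Finset α} (hT : T.card ≤ D) :
    ∑ S, q S * knapsackMatrix α r S T = knapsackMoment (Fintype.card α) r D D * q T := by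
  set N := Fintype.card α
  -- Expanding over the subsets `J` of `S ∩ T` makes the coefficient independent of `S`, because `|S
  -- ∪ T| + |S ∩ T| = D + |T|`. Summing over `S` then leaves star sums of `q`, which vanish unless
  -- `J = T` and `|T| = D`.
  have hexp : ∀ S, q S * knapsackMatrix α r S T =
      ∑ J ∈ T.powerset, if J ⊆ S then
        q S * knapsackMoment N r (D + T.card - J.card) J.card else 0 := by
    intro S
    by_cases hS : S.card = D
    · have hc := Finset.card_union_add_card_inter S T
      rw [knapsackMatrix, knapsackMoment_eq_sum_powerset r (S ∩ T) _ _ (by omega), hc,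
        Finset.mul_sum, ← Finset.sum_filter]
      have : T.powerset.filter (fun J => J ⊆ S) = (S ∩ T).powerset := by
        ext J
        simp only [Finset.mem_filter, Finset.mem_powerset, Finset.subset_inter_iff]
        tauto
      rw [this]
      simp [hS, N]
    · simp [hq S hS]
  simp only [hexp]
  rw [Finset.sum_comm, Finset.sum_eq_single_of_mem T (by simp)]
  · by_cases hTD : T.card = D
    · rw [Finset.sum_eq_single T]
      · simp [hTD, mul_comm]
      · intro S _ hST
        by_cases hS : S.card = D
        · refine if_neg fun h => hST (Finset.eq_of_subset_of_card_le h (by omega)).symm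
        · simp [hq S hS]
      · simp
    · rw [hq T hTD, mul_zero, ← Finset.sum_filter, ← Finset.sum_mul,
        sum_superset_eq_zero hq horth (D - 1 - T.card) T (by omega), zero_mul]
  · intro J hJ hJT
    have hlt : J.card < T.card := Finset.card_lt_card
      ((Finset.mem_powerset.1 hJ).ssubset_of_ne hJT)
    rw [← Finset.sum_filter, ← Finset.sum_mul,
      sum_superset_eq_zero hq horth (D - 1 - J.card) J (by omega), zero_mul]

/-- The smallest factor `2k - r - l` is at least `2k - (k + 1) - (k - 1) = 0`; this is where the sum
may not exceed `k + 1`. -/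
theorem knapsackMoment_nonneg {k : ℕ} {r : ℝ} (h1 : (k : ℝ) ≤ r) (h2 : r ≤ k + 1) {D : ℕ}
    (hD : D ≤ k) : 0 ≤ knapsackMoment (2 * k) r D D := by
  refine div_nonneg (mul_nonneg ?_ ?_) (prod_range_natCast_sub_pos (by omega)).le
  · refine Finset.prod_nonneg fun l hl => ?_
    have : (l : ℝ) + 1 ≤ k := by exact_mod_cast (Finset.mem_range.1 hl).trans_le hD
    linarith
  · refine Finset.prod_nonneg fun l hl => ?_
    have : (l : ℝ) + 1 ≤ k := by exact_mod_cast (Finset.mem_range.1 hl).trans_le hD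
    push_cast
    linarith

/-- Induction on the degree. The top part `t` of `h` is projected onto the span of stars: `t = p +
q` with `q` harmonic. The knapsack equation rewrites `p` in lower degree, so `h` acts as `q + w`
with `w` of lower degree. Here `q` is an eigenvector with nonnegative eigenvalue, the cross term
vanishes because `q` and `w` have disjoint supports, and `w` is covered by induction. -/
theorem knapsackMatrix_form_nonneg {k : ℕ} {r : ℝ} (hα : Fintype.card α = 2 * k)
    (h1 : (k : ℝ) ≤ r) (h2 : r ≤ k + 1) : ∀ D ≤ k + 1, ∀ h : Finset α → ℝ,
      (∀ S, D ≤ S.card → h S = 0) → 0 ≤ h ⬝ᵥ knapsackMatrix α r *ᵥ h := by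
  have hsymm : ∀ x y : Finset α → ℝ,
      x ⬝ᵥ knapsackMatrix α r *ᵥ y = y ⬝ᵥ knapsackMatrix α r *ᵥ x := by
    intro x y
    have ht : (knapsackMatrix α r)ᵀ = knapsackMatrix α r := by
      ext S T; exact knapsackMatrix_comm r T S
    conv_rhs => rw [dotProduct_comm, ← vecMul_transpose, ht, ← dotProduct_mulVec]
  have hcol : ∀ x y : Finset α → ℝ, x ⬝ᵥ knapsackMatrix α r *ᵥ y =
      ∑ T, (∑ S, x S * knapsackMatrix α r S T) * y T := by
    intro x y
    rw [dotProduct_mulVec]; rfl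
  intro D
  induction D with
  | zero =>
    intro _ h hh
    have : h = 0 := funext fun S => hh S (Nat.zero_le _)
    simp [this]
  | succ D ih =>
    intro hD h hh
    let u : {J : Finset α // J.card + 1 = D} → Finset α → ℝ := fun J => coverIndicator J.1
    let t : Finset α → ℝ := fun S => if S.card = D then h S else 0
    obtain ⟨g, hg⟩ := exists_normal_equations u t
    let p : Finset α → ℝ := fun S => ∑ J, g J * u J S
    let q : Finset α → ℝ := fun S => t S - p S
    let p' : Finset α → ℝ := fun S => ∑ J, g J * ((r - J.1.card) * if J.1 = S then 1 else 0)
    let w : Finset α → ℝ := fun S => (h S - t S) + p' S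
    have hp : ∀ S, S.card ≠ D → p S = 0 := by
      intro S hS
      refine Finset.sum_eq_zero fun J _ => ?_
      have : ¬(J.1 ⊆ S ∧ S.card = J.1.card + 1) := fun h => hS (h.2.trans J.2)
      simp only [u, coverIndicator, if_neg this, mul_zero]
    have hq : ∀ S, S.card ≠ D → q S = 0 := by
      intro S hS
      simp [q, hp S hS, t, hS]
    have horth : ∀ J : Finset α, J.card + 1 = D → ∑ S, coverIndicator J S * q S = 0 :=
      fun J hJ => hg ⟨J, hJ⟩
    have hw : ∀ S, D ≤ S.card → w S = 0 := by
      intro S hS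
      have hp' : p' S = 0 := by
        refine Finset.sum_eq_zero fun J _ => ?_
        have : J.1 ≠ S := by rintro rfl; have := J.2; omega
        simp [this]
      rcases hS.eq_or_lt with hS | hS
      · simp [w, hp', t, hS.symm]
      · simp [w, hp', t, hh S hS, hS.ne']
    have hpp' : ∀ x : Finset α → ℝ, (∀ S, D < S.card → x S = 0) →
        p ⬝ᵥ knapsackMatrix α r *ᵥ x = p' ⬝ᵥ knapsackMatrix α r *ᵥ x := by
      intro x hx
      rw [hcol, hcol]
      refine Finset.sum_congr rfl fun T _ => ?_
      by_cases hT : D < T.card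
      · simp [hx T hT]
      congr 1
      simp only [p, p', Finset.sum_mul]
      rw [Finset.sum_comm, Finset.sum_comm (s := Finset.univ (α := Finset α))]
      refine Finset.sum_congr rfl fun J _ => ?_
      have hJT : (J.1 ∪ T).card < Fintype.card α := by
        have := Finset.card_union_le J.1 T
        have := J.2
        omega
      have := sum_coverIndicator_mul_knapsackMatrix r hJT
      simp only [mul_assoc, ← Finset.mul_sum]
      rw [this]
      simp
    have hsum : h = q + p + (w - p') := by
      ext S; simp only [q, w, Pi.add_apply, Pi.sub_apply]; ring
    have hwD : ∀ S, D < S.card → w S = 0 := fun S hS => hw S hS.le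
    have hqD : ∀ S, D < S.card → q S = 0 := fun S hS => hq S hS.ne'
    have hqx : ∀ x : Finset α → ℝ, (∀ S, D < S.card → x S = 0) →
        q ⬝ᵥ knapsackMatrix α r *ᵥ x = knapsackMoment (2 * k) r D D * ∑ T, q T * x T := by
      intro x hx
      rw [hcol, Finset.mul_sum]
      refine Finset.sum_congr rfl fun T _ => ?_
      by_cases hT : D < T.card
      · simp [hx T hT]
      rw [sum_mul_knapsackMatrix_of_harmonic r (by omega) hq horth (not_lt.1 hT), hα]
      ring
    have hqw : q ⬝ᵥ knapsackMatrix α r *ᵥ w = 0 := by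
      rw [hqx w hwD]
      have : ∑ T, q T * w T = 0 := by
        refine Finset.sum_eq_zero fun T _ => ?_
        by_cases hT : T.card = D
        · rw [hw T hT.ge, mul_zero]
        · rw [hq T hT, zero_mul]
      rw [this, mul_zero]
    have hqq : 0 ≤ q ⬝ᵥ knapsackMatrix α r *ᵥ q := by
      rw [hqx q hqD]
      exact mul_nonneg (knapsackMoment_nonneg h1 h2 (by omega))
        (Finset.sum_nonneg fun T _ => mul_self_nonneg _)
    have hww : 0 ≤ w ⬝ᵥ knapsackMatrix α r *ᵥ w := ih (by omega) w hw
    have hhD : ∀ S, D < S.card → h S = 0 := fun S hS => hh S hS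
    have hred : ∀ x : Finset α → ℝ, (∀ S, D < S.card → x S = 0) →
        h ⬝ᵥ knapsackMatrix α r *ᵥ x = (q + w) ⬝ᵥ knapsackMatrix α r *ᵥ x := by
      intro x hx
      rw [hsum]
      simp only [add_dotProduct, sub_dotProduct, hpp' x hx]
      ring
    have hqwD : ∀ S, D < S.card → (q + w) S = 0 := fun S hS => by
      simp [hqD S hS, hwD S hS]
    -- The replacement of `h` by `q + w` is valid only against vectors of degree at most `D`, so it
    -- is made in one argument at a time.
    rw [hred h hhD, hsymm, hred _ hqwD]
    simp only [add_dotProduct, mulVec_add, dotProduct_add]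
    rw [hsymm w q, hqw]
    linarith

/-- The knapsack moment matrix of `2k` Boolean variables with sum in `[k, k+1]` is positive
semidefinite in degree `2k`. -/
theorem knapsackMatrix_posSemidef {k : ℕ} {r : ℝ} (hα : Fintype.card α = 2 * k)
    (h1 : (k : ℝ) ≤ r) (h2 : r ≤ k + 1) :
    ((knapsackMatrix α r).submatrix (fun S : {S : Finset α // S.card ≤ k} => S.1)
      (fun S : {S : Finset α // S.card ≤ k} => S.1)).PosSemidef := by
  refine .of_dotProduct_mulVec_nonneg ?_ fun x => ?_
  · ext S T
    simp [knapsackMatrix_comm r T.1 S.1]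
  · let h : Finset α → ℝ := fun S => if hS : S.card ≤ k then x ⟨S, hS⟩ else 0
    have key := knapsackMatrix_form_nonneg hα h1 h2 (k + 1) le_rfl h fun S hS => by
      simp [h, Nat.not_le.2 hS]
    have hs : ∀ F : Finset α → ℝ, ∑ S, h S * F S =
        ∑ S : {S : Finset α // S.card ≤ k}, x S * F S.1 := by
      intro F
      have h0 : ∑ S, h S * F S =
          ∑ S ∈ Finset.univ.filter (fun S : Finset α => S.card ≤ k), h S * F S := by
        rw [Finset.sum_filter]
        refine Finset.sum_congr rfl fun S _ => ?_
        by_cases hS : S.card ≤ k <;> simp [h, hS]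
      rw [h0, Finset.sum_subtype _ (p := fun S : Finset α => S.card ≤ k) (by simp)]
      refine Finset.sum_congr rfl fun S _ => ?_
      simp [h, S.2]
    refine key.trans_eq ?_
    simp only [dotProduct, mulVec, hs, star_trivial, submatrix_apply]
    refine Finset.sum_congr rfl fun S _ => ?_
    simp only [mul_comm (knapsackMatrix α r _ _), hs]

/-- For `s ≤ k` the moment is a product of ratios in `[0, 1]`. Otherwise split an `s`-set `U` into
`S` and `T = U \ S` of size at most `k`: positivity on `(x_S ± x_T) ^ 2` gives `2 |E x_U| ≤ E x_S +
E x_T ≤ 2`. -/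
theorem abs_knapsackMoment_le_one {k : ℕ} {r : ℝ} (h1 : (k : ℝ) ≤ r) (h2 : r ≤ k + 1)
    {s : ℕ} (hs : s ≤ 2 * k) : |knapsackMoment (2 * k) r s 0| ≤ 1 := by
  have hsmall : ∀ a ≤ k, knapsackMoment (2 * k) r a 0 ≤ 1 := by
    intro a ha
    simp only [knapsackMoment, Finset.prod_range_zero, mul_one, add_zero]
    rw [div_le_one (prod_range_natCast_sub_pos (by omega))]
    refine Finset.prod_le_prod (fun l hl => ?_) fun l hl => ?_ <;>
    · have hl' : (l : ℝ) + 1 ≤ k := by exact_mod_cast (Finset.mem_range.1 hl).trans_le ha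
      have : (0 : ℝ) ≤ l := l.cast_nonneg
      push_cast
      linarith
  obtain ⟨U, -, hU⟩ := Finset.exists_subset_card_eq
    (s := (Finset.univ : Finset (Fin (2 * k)))) (n := s) (by simpa using hs)
  obtain ⟨S, hSU, hS⟩ := Finset.exists_subset_card_eq (s := U) (n := min s k) (by omega)
  have hT : (U \ S).card = s - min s k := by rw [Finset.card_sdiff_of_subset hSU, hU, hS]
  have hST : (S ∪ U \ S).card = s := by rw [Finset.union_sdiff_of_subset hSU, hU]
  have hST' : (U \ S ∪ S).card = s := by rw [Finset.union_comm, hST]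
  have hpsd := knapsackMatrix_form_nonneg (α := Fin (2 * k)) (by simp) h1 h2 (k + 1) le_rfl
  have hval : ∀ y : ℝ, (Pi.single S 1 + Pi.single (U \ S) y) ⬝ᵥ
      knapsackMatrix (Fin (2 * k)) r *ᵥ (Pi.single S 1 + Pi.single (U \ S) y) =
      knapsackMoment (2 * k) r S.card 0 + 2 * y * knapsackMoment (2 * k) r s 0 +
        y ^ 2 * knapsackMoment (2 * k) r (U \ S).card 0 := by
    intro y
    simp only [add_dotProduct, mulVec_add, dotProduct_add, mulVec_single, single_dotProduct,
      knapsackMatrix, Pi.smul_apply, MulOpposite.smul_eq_mul_unop, MulOpposite.unop_op, col_apply,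
      Finset.union_self, hST, hST', Fintype.card_fin]
    ring
  have hsupp : ∀ (y : ℝ) (V : Finset (Fin (2 * k))), k + 1 ≤ V.card →
      (Pi.single S (1 : ℝ) + Pi.single (U \ S) y : Finset (Fin (2 * k)) → ℝ) V = 0 := by
    intro y V hV
    have hV1 : V ≠ S := by rintro rfl; omega
    have hV2 : V ≠ U \ S := by rintro rfl; omega
    simp [hV1, hV2]
  have e1 := hpsd _ (hsupp 1)
  have e2 := hpsd _ (hsupp (-1))
  rw [hval] at e1 e2
  have b1 := hsmall S.card (by omega)
  have b2 := hsmall (U \ S).card (by omega)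
  rw [abs_le]
  constructor <;> linarith

end Knapsack

/-! ### The product of the knapsack pseudo-expectations over the blocks -/

theorem card_block {n m k i : ℕ} (hk : 1 ≤ k) (hn : 2 * k * m ≤ n) (hi : i < m) :
    (Finset.univ.filter fun j : Fin n => j.val / (2 * k) = i).card = 2 * k := by
  have hb : 2 * k * (i + 1) ≤ n := (Nat.mul_le_mul_left _ hi).trans hn
  have hmap : (Finset.univ.filter fun j : Fin n => j.val / (2 * k) = i).map Fin.valEmbedding =
      Finset.Ico (2 * k * i) (2 * k * (i + 1)) := by
    ext x
    simp only [Finset.mem_map, Finset.mem_filter, Finset.mem_univ, true_and, Fin.valEmbedding_apply,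
      Finset.mem_Ico]
    constructor
    · rintro ⟨j, hj, rfl⟩
      rw [Nat.div_eq_iff (by omega)] at hj
      rw [mul_add, mul_comm (2 * k) i]
      omega
    · rintro ⟨h1, h2⟩
      refine ⟨⟨x, h2.trans_le hb⟩, ?_, rfl⟩
      rw [Nat.div_eq_iff (by omega)]
      rw [mul_add, mul_comm (2 * k) i] at h2
      rw [mul_comm (2 * k) i] at h1
      simp only
      omega
  rw [← Finset.card_map Fin.valEmbedding, hmap, Nat.card_Ico, mul_add]
  omega

/-- The Schur product theorem, iterated from the all-ones matrix. -/
theorem Matrix.posSemidef_prod {ι κ : Type*} (s : Finset κ) (A : κ → Matrix ι ι ℝ)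
    (hA : ∀ i ∈ s, (A i).PosSemidef) :
    (Matrix.of fun a b => ∏ i ∈ s, A i a b).PosSemidef := by
  classical
  induction s using Finset.induction_on with
  | empty =>
    refine ⟨by ext a b; simp, fun x => ?_⟩
    simp only [Matrix.of_apply, Finset.prod_empty, star_trivial, mul_one, Finsupp.sum,
      ← Finset.mul_sum, ← Finset.sum_mul]
    exact mul_self_nonneg _
  | insert i s hi ih =>
    have heq : (Matrix.of fun a b => ∏ i ∈ insert i s, A i a b) =
        (A i).hadamard (Matrix.of fun a b => ∏ i ∈ s, A i a b) := by
      ext a b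
      simp [Finset.prod_insert hi]
    rw [heq]
    exact (hA i (by simp)).hadamard (ih fun j hj => hA j (by simp [hj]))

/-- The value of the product of the knapsack pseudo-expectations of the `m` blocks at the product
of the variables in `S`; the sum of block `i` is `k + η i`. -/
noncomputable def blockMoment (n m k : ℕ) (η : ℕ → ℝ) (S : Finset (Fin n)) : ℝ :=
  ∏ i ∈ Finset.range m,
    knapsackMoment (2 * k) (k + η i) (S.filter fun j => j.val / (2 * k) = i).card 0

/-- The pseudo-expectation with moments `blockMoment`. -/
noncomputable def pseudoExp (n m k : ℕ) (η : ℕ → ℝ) : MvPolynomial (Fin n) ℝ →ₗ[ℝ] ℝ :=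
  (basisMonomials (Fin n) ℝ).constr ℝ fun M => blockMoment n m k η M.support

section PseudoExp

variable {n m k : ℕ} {η : ℕ → ℝ}

theorem pseudoExp_monomial (M : Fin n →₀ ℕ) :
    pseudoExp n m k η (monomial M 1) = blockMoment n m k η M.support := by
  have := (basisMonomials (Fin n) ℝ).constr_basis ℝ (fun M => blockMoment n m k η M.support) M
  rwa [coe_basisMonomials] at this

theorem pseudoExp_mul (p g : MvPolynomial (Fin n) ℝ) :
    pseudoExp n m k η (p * g) =
      ∑ M ∈ p.support, coeff M p * pseudoExp n m k η (monomial M 1 * g) := by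
  conv_lhs => rw [p.as_sum, Finset.sum_mul, map_sum]
  refine Finset.sum_congr rfl fun M _ => ?_
  rw [← smul_eq_mul (coeff M p), ← map_smul, ← smul_mul_assoc, smul_monomial, smul_eq_mul, mul_one]

theorem pseudoExp_eq_sum (p : MvPolynomial (Fin n) ℝ) :
    pseudoExp n m k η p = ∑ M ∈ p.support, coeff M p * blockMoment n m k η M.support := by
  have := pseudoExp_mul (m := m) (k := k) (η := η) p 1
  simpa [pseudoExp_monomial] using this

theorem pseudoExp_one : pseudoExp n m k η 1 = 1 := by
  have := pseudoExp_monomial (m := m) (k := k) (η := η) (0 : Fin n →₀ ℕ)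
  simpa [blockMoment, knapsackMoment_zero_zero] using this

theorem pseudoExp_monomial_mul_X_pow (M : Fin n →₀ ℕ) (j : Fin n) {a : ℕ} (ha : a ≠ 0) :
    pseudoExp n m k η (monomial M 1 * X j ^ a) = blockMoment n m k η (insert j M.support) := by
  rw [X_pow_eq_monomial, monomial_mul, one_mul, pseudoExp_monomial, Finsupp.support_add_eq_union,
    Finsupp.support_single _ ha, Finset.union_comm, Finset.insert_eq]

/-- Holds in every degree, since a moment depends only on the support of the monomial. This includes
the variables outside all blocks, which are in effect set to 1. -/
theorem pseudoExp_mul_boolean (p : MvPolynomial (Fin n) ℝ) (j : Fin n) :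
    pseudoExp n m k η (p * (X j ^ 2 - X j)) = 0 := by
  rw [pseudoExp_mul]
  refine Finset.sum_eq_zero fun M _ => ?_
  have h1 := pseudoExp_monomial_mul_X_pow (m := m) (k := k) (η := η) M j one_ne_zero
  rw [pow_one] at h1
  rw [mul_sub, map_sub, pseudoExp_monomial_mul_X_pow _ _ two_ne_zero, h1, sub_self, mul_zero]

theorem card_support_le_totalDegree {σ : Type*} {p : MvPolynomial σ ℝ} {M : σ →₀ ℕ}
    (hM : M ∈ p.support) : M.support.card ≤ p.totalDegree := by
  refine le_trans ?_ (le_totalDegree hM)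
  rw [Finset.card_eq_sum_ones]
  exact Finset.sum_le_sum fun j hj => Nat.one_le_iff_ne_zero.2 (Finsupp.mem_support_iff.1 hj)

/-- Only the factor of block `i` changes. The bound on `S` keeps the block from being full, where
the knapsack equation would fail in general. -/
theorem sum_blockMoment_insert (hk : 1 ≤ k) (hn : 2 * k * m ≤ n) {i : ℕ} (hi : i < m)
    {S : Finset (Fin n)} (hS : S.card < 2 * k) :
    ∑ j : Fin n with j.val / (2 * k) = i, blockMoment n m k η (insert j S) =
      (k + η i) * blockMoment n m k η S := by
  have hB := card_block hk hn hi
  have hi' := Finset.mem_range.2 hi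
  set B := Finset.univ.filter fun j : Fin n => j.val / (2 * k) = i with hBdef
  have hU : (S.filter fun j => j.val / (2 * k) = i) ⊂ B := by
    refine Finset.ssubset_iff_subset_ne.2 ⟨Finset.filter_subset_filter _ (Finset.subset_univ _), ?_⟩
    intro h
    have := Finset.card_filter_le S fun j => j.val / (2 * k) = i
    rw [h] at this
    omega
  have key := sum_knapsackMoment_insert (k + η i) hU
  rw [hB] at key
  have hterm : ∀ j ∈ B, blockMoment n m k η (insert j S) =
      knapsackMoment (2 * k) (k + η i)
        (insert j (S.filter fun j => j.val / (2 * k) = i)).card 0 *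
      ∏ i' ∈ (Finset.range m).erase i,
        knapsackMoment (2 * k) (k + η i') (S.filter fun j => j.val / (2 * k) = i').card 0 := by
    intro j hj
    have hj' : j.val / (2 * k) = i := (Finset.mem_filter.1 hj).2
    rw [blockMoment, ← Finset.mul_prod_erase _ _ hi', Finset.filter_insert, if_pos hj']
    congr 1
    refine Finset.prod_congr rfl fun i' hi'' => ?_
    rw [Finset.filter_insert, if_neg]
    rw [hj']
    exact (Finset.ne_of_mem_erase hi'').symm
  rw [Finset.sum_congr rfl hterm, ← Finset.sum_mul, key, mul_assoc, blockMoment,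
    Finset.mul_prod_erase _ (fun i' => knapsackMoment (2 * k) (k + η i')
      (S.filter fun j => j.val / (2 * k) = i').card 0) hi']

/-- Up to degree `2k`, the pseudo-expectation satisfies `yᵢ = η i`. -/
theorem pseudoExp_mul_blockForm (hk : 1 ≤ k) (hn : 2 * k * m ≤ n) {i : ℕ} (hi : i < m)
    {p : MvPolynomial (Fin n) ℝ} (hp : p.totalDegree < 2 * k) :
    pseudoExp n m k η (p * blockForm n k i) = η i * pseudoExp n m k η p := by
  rw [pseudoExp_mul, pseudoExp_eq_sum p, Finset.mul_sum]
  refine Finset.sum_congr rfl fun M hM => ?_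
  have hS : M.support.card < 2 * k := (card_support_le_totalDegree hM).trans_lt hp
  have hX : ∀ j, pseudoExp n m k η (monomial M 1 * X j) =
      blockMoment n m k η (insert j M.support) := fun j => by
    simpa using pseudoExp_monomial_mul_X_pow (m := m) (k := k) (η := η) M j one_ne_zero
  have hC : pseudoExp n m k η (monomial M 1 * C (k : ℝ)) =
      k * blockMoment n m k η M.support := by
    rw [mul_comm, ← smul_eq_C_mul, map_smul, pseudoExp_monomial, smul_eq_mul]
  rw [blockForm, mul_sub, map_sub, Finset.mul_sum, map_sum, hC, Finset.sum_congr rfl fun j _ => hX j,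
    sum_blockMoment_insert hk hn hi hS]
  ring

theorem abs_blockMoment_le_one (hk : 1 ≤ k) (hn : 2 * k * m ≤ n)
    (hη0 : ∀ i, 0 ≤ η i) (hη1 : ∀ i, η i ≤ 1) (S : Finset (Fin n)) :
    |blockMoment n m k η S| ≤ 1 := by
  rw [blockMoment, Finset.abs_prod]
  refine Finset.prod_le_one (fun _ _ => abs_nonneg _) fun i hi => ?_
  refine abs_knapsackMoment_le_one (by linarith [hη0 i]) (by linarith [hη1 i]) ?_
  refine le_trans ?_ (card_block hk hn (Finset.mem_range.1 hi)).le
  exact Finset.card_le_card (Finset.filter_subset_filter _ (Finset.subset_univ _))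

/-- The value is the quadratic form of the coefficient vector of `h` in a matrix that is the
entrywise product over the blocks of knapsack matrices, indexed by the traces of the monomials on
the block. -/
theorem pseudoExp_sq_nonneg (hk : 1 ≤ k) (hn : 2 * k * m ≤ n)
    (hη0 : ∀ i, 0 ≤ η i) (hη1 : ∀ i, η i ≤ 1) {h : MvPolynomial (Fin n) ℝ}
    (hh : h.totalDegree ≤ k) : 0 ≤ pseudoExp n m k η (h ^ 2) := by
  let e : ∀ i, h.support → {S : Finset {j : Fin n // j.val / (2 * k) = i} // S.card ≤ k} :=
    fun i M => ⟨M.1.support.subtype _, by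
      rw [Finset.card_subtype]
      exact (Finset.card_filter_le _ _).trans ((card_support_le_totalDegree M.2).trans hh)⟩
  let A : ℕ → Matrix h.support h.support ℝ := fun i =>
    Matrix.of fun M M' =>
      knapsackMatrix {j : Fin n // j.val / (2 * k) = i} (k + η i) (e i M).1 (e i M').1
  have hA : ∀ i ∈ Finset.range m, (A i).PosSemidef := by
    intro i hi
    have hcard : Fintype.card {j : Fin n // j.val / (2 * k) = i} = 2 * k := by
      rw [Fintype.card_subtype, card_block hk hn (Finset.mem_range.1 hi)]
    exact (knapsackMatrix_posSemidef hcard (r := k + η i)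
      (by linarith [hη0 i]) (by linarith [hη1 i])).submatrix (e i)
  have hpsd := Matrix.posSemidef_prod (Finset.range m) A hA
  have hent : ∀ M M' : h.support, blockMoment n m k η (M.1.support ∪ M'.1.support) =
      ∏ i ∈ Finset.range m,
        knapsackMatrix {j : Fin n // j.val / (2 * k) = i} (k + η i) (e i M).1 (e i M').1 := by
    intro M M'
    refine Finset.prod_congr rfl fun i hi => ?_
    rw [knapsackMatrix, Fintype.card_subtype, card_block hk hn (Finset.mem_range.1 hi),
      ← Finset.card_subtype]
    congr 2
    ext j
    simp [e]
  have key := hpsd.dotProduct_mulVec_nonneg fun M => coeff M.1 h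
  refine key.trans_eq ?_
  rw [sq, pseudoExp_mul, ← Finset.sum_coe_sort]
  simp only [dotProduct, Matrix.mulVec, star_trivial, Matrix.of_apply]
  refine Finset.sum_congr rfl fun M _ => ?_
  congr 1
  rw [mul_comm (monomial M.1 1) h, pseudoExp_mul,
    ← Finset.sum_coe_sort h.support fun M' =>
      coeff M' h * pseudoExp n m k η (monomial M' 1 * monomial M.1 1)]
  refine Finset.sum_congr rfl fun M' _ => ?_
  rw [monomial_mul, one_mul, pseudoExp_monomial, Finsupp.support_add_eq_union, Finset.union_comm,
    hent, mul_comm]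
  rfl

end PseudoExp

/-! ### Counting monomials; degrees and coefficients of the system -/

/-- A monomial of degree at most `d + 1` is one of degree at most `d` times 1 or a variable. -/
theorem exists_finset_degree_le {σ : Type*} [Fintype σ] (d : ℕ) :
    ∃ A : Finset (σ →₀ ℕ), A.card ≤ (Fintype.card σ + 1) ^ d ∧ ∀ M, M.degree ≤ d → M ∈ A := by
  classical
  induction d with
  | zero =>
    refine ⟨{0}, by simp, fun M hM => ?_⟩
    simpa [Finsupp.degree_eq_zero_iff] using hM
  | succ d ih =>
    obtain ⟨A, hA, hmem⟩ := ih
    refine ⟨(A ×ˢ (Finset.univ : Finset (Option σ))).image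
      fun p => p.1 + p.2.elim 0 fun j => Finsupp.single j 1, ?_, fun M hM => ?_⟩
    · refine Finset.card_image_le.trans ?_
      rw [Finset.card_product, Finset.card_univ, Fintype.card_option, pow_succ]
      exact Nat.mul_le_mul_right _ hA
    · rw [Finset.mem_image]
      by_cases h0 : M = 0
      · exact ⟨(0, none), by simp [hmem 0 (by simp)], by simp [h0]⟩
      · obtain ⟨j, hj⟩ := Finsupp.ne_iff.1 h0
        have hle : Finsupp.single j 1 ≤ M := by
          rw [Finsupp.single_le_iff]
          exact Nat.one_le_iff_ne_zero.2 hj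
        have hM' : M - Finsupp.single j 1 + Finsupp.single j 1 = M := tsub_add_cancel_of_le hle
        refine ⟨(M - Finsupp.single j 1, some j), ?_, hM'⟩
        simp only [Finset.mem_product, Finset.mem_univ, and_true]
        apply hmem
        have := congrArg Finsupp.degree hM'
        rw [map_add, Finsupp.degree_single] at this
        omega

theorem card_support_le {n d : ℕ} {p : MvPolynomial (Fin n) ℝ} (hp : p.totalDegree ≤ d) :
    p.support.card ≤ (n + 1) ^ d := by
  obtain ⟨A, hA, hmem⟩ := exists_finset_degree_le (σ := Fin n) d
  rw [Fintype.card_fin] at hA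
  refine (Finset.card_le_card fun M hM => hmem M ?_).trans hA
  exact (le_totalDegree hM).trans hp

theorem totalDegree_blockForm_le (n k i : ℕ) : (blockForm n k i).totalDegree ≤ 1 := by
  refine (totalDegree_sub _ _).trans (max_le ?_ ((totalDegree_C _).trans_le zero_le_one))
  refine totalDegree_finsetSum_le fun j _ => ?_
  simp

theorem coeff_single_blockForm {n k i : ℕ} {j : Fin n} (hj : j.val / (2 * k) = i) :
    coeff (Finsupp.single j 1) (blockForm n k i) = 1 := by
  rw [blockForm, coeff_sub, coeff_sum, coeff_C, if_neg, sub_zero,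
    Finset.sum_eq_single_of_mem j (by simp [hj])]
  · simp
  · intro j' _ hne
    rw [coeff_X, if_neg]
    rwa [Finsupp.single_left_inj one_ne_zero]
  · intro h
    exact one_ne_zero (Finsupp.single_eq_zero.1 h.symm)

section Blocks

variable {n m k i : ℕ}

theorem totalDegree_blockForm (hk : 1 ≤ k) (hn : 2 * k * m ≤ n) (hi : i < m) :
    (blockForm n k i).totalDegree = 1 := by
  refine le_antisymm (totalDegree_blockForm_le n k i) ?_
  obtain ⟨j, hj⟩ := Finset.card_pos.1 (by rw [card_block hk hn hi]; omega)
  have hj' : j.val / (2 * k) = i := (Finset.mem_filter.1 hj).2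
  have hmem : Finsupp.single j 1 ∈ (blockForm n k i).support := by
    rw [mem_support_iff, coeff_single_blockForm hj']
    exact one_ne_zero
  simpa using le_totalDegree hmem

theorem totalDegree_blockForm_sq (hk : 1 ≤ k) (hn : 2 * k * m ≤ n) (hi : i < m) :
    (blockForm n k i ^ 2).totalDegree = 2 := by
  have h1 := totalDegree_blockForm hk hn hi
  have h0 : blockForm n k i ≠ 0 := by
    intro h
    simp [h] at h1
  rw [sq, totalDegree_mul_of_isDomain h0 h0, h1]

theorem totalDegree_squaringSystem (hk : 1 ≤ k) (hn : 2 * k * m ≤ n) (s : Fin n ⊕ Fin m) :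
    (squaringSystem n m k s).totalDegree = 2 := by
  have hsub : ∀ p q : MvPolynomial (Fin n) ℝ, p.totalDegree = 2 → q.totalDegree ≤ 1 →
      (p - q).totalDegree = 2 := by
    intro p q hp hq
    rw [sub_eq_add_neg, totalDegree_add_eq_left_of_totalDegree_lt, hp]
    rw [totalDegree_neg, hp]
    omega
  rcases s with j | i
  · exact hsub _ _ (totalDegree_X_pow j 2) (totalDegree_X j).le
  · rw [squaringSystem]
    split_ifs with h
    · exact hsub _ _ (totalDegree_blockForm_sq hk hn i.2) (totalDegree_blockForm_le _ _ _)
    · exact totalDegree_blockForm_sq hk hn i.2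

theorem abs_coeff_blockForm_le (hk : 1 ≤ k) (hn : 2 * k * m ≤ n) (hi : i < m)
    (M : Fin n →₀ ℕ) : |coeff M (blockForm n k i)| ≤ 3 * k := by
  have h1 : |coeff M (∑ j : Fin n with j.val / (2 * k) = i, (X j : MvPolynomial (Fin n) ℝ))| ≤
      2 * k := by
    rw [coeff_sum]
    refine (Finset.abs_sum_le_sum_abs _ _).trans ?_
    refine (Finset.sum_le_card_nsmul _ _ 1 fun j _ => ?_).trans_eq ?_
    · rw [coeff_X]
      split_ifs <;> simp
    · rw [card_block hk hn hi]
      simp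
  have h2 : |coeff M (C (k : ℝ) : MvPolynomial (Fin n) ℝ)| ≤ k := by
    rw [coeff_C]
    split_ifs <;> simp
  rw [blockForm, coeff_sub]
  refine (abs_sub _ _).trans ?_
  linarith

end Blocks

/-! ### Upper bound: an explicit certificate of degree 2 -/

/-- Eliminating `y₀, y₁, …` one after the other by completing squares. -/
noncomputable def squaringCertificate (n m k : ℕ) (hm : 1 ≤ m) :
    SoSCertificate (squaringSystem n m k) (C (1 / 32) - blockForm n k 0) where
  t := m
  -- With `c i = (8m) ^ (2 ^ i - 1)`, so that `c (i + 1) = 8m * c i ^ 2`, the square of `h i` is `1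
  -- / (32m) - c i * yᵢ + c (i + 1) * yᵢ ^ 2`. The constants of the `m` squares add up to `ε = 1 /
  -- 32`.
  h i := C (1 / (2 * √(8 * m))) - C ((8 * m : ℝ) ^ (2 ^ i.val - 1) * √(8 * m)) * blockForm n k i
  mult
    | Sum.inl _ => 0
    | Sum.inr i => - C ((8 * m : ℝ) ^ (2 ^ (i.val + 1) - 1))
  identity := by
    have hm0 : (0 : ℝ) < 8 * m := by positivity
    have hu : √(8 * m : ℝ) * √(8 * m : ℝ) = 8 * m := Real.mul_self_sqrt hm0.le
    have hu0 : √(8 * m : ℝ) ≠ 0 := (Real.sqrt_pos.2 hm0).ne'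
    -- Setting `y m = 0` gives the last equation the shape of the others, and the sum telescopes to
    -- `-y 0`.
    let y : ℕ → MvPolynomial (Fin n) ℝ := fun i => if i < m then blockForm n k i else 0
    let c : ℕ → ℝ := fun i => (8 * m : ℝ) ^ (2 ^ i - 1)
    have hc : ∀ i, c (i + 1) = (c i * √(8 * m)) * (c i * √(8 * m)) := by
      intro i
      have h2 : 2 ^ (i + 1) - 1 = (2 ^ i - 1) + (2 ^ i - 1) + 1 := by
        have := Nat.one_le_two_pow (n := i)
        rw [pow_succ]
        omega
      change (8 * m : ℝ) ^ (2 ^ (i + 1) - 1) = _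
      rw [h2, pow_succ, pow_add]
      linear_combination -(8 * m : ℝ) ^ (2 ^ i - 1) * (8 * m : ℝ) ^ (2 ^ i - 1) * hu
    have hterm : ∀ i : Fin m,
        (C (1 / (2 * √(8 * m))) - C (c i * √(8 * m)) * blockForm n k i) ^ 2 +
          (- C (c (i + 1))) * squaringSystem n m k (Sum.inr i) =
        C (1 / (32 * m) : ℝ) + (C (c (i + 1)) * y (i + 1) - C (c i) * y i) := by
      intro i
      have hs : squaringSystem n m k (Sum.inr i) = blockForm n k i ^ 2 - y (i + 1) := by
        simp only [squaringSystem, y]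
        split_ifs <;> simp
      have hy : y i = blockForm n k i := if_pos i.2
      have e1 : (C (1 / (2 * √(8 * m))) : MvPolynomial (Fin n) ℝ) ^ 2 =
          C (1 / (32 * m) : ℝ) := by
        rw [← C_pow]
        congr 1
        rw [div_pow, mul_pow, sq √(8 * m : ℝ), hu]
        norm_num
        ring
      have e2 : (2 : MvPolynomial (Fin n) ℝ) * C (1 / (2 * √(8 * m))) * C (c i * √(8 * m)) =
          C (c i) := by
        rw [← map_ofNat C 2, ← C_mul, ← C_mul]
        congr 1
        field_simp
      have e3 : (C (c i * √(8 * m)) : MvPolynomial (Fin n) ℝ) ^ 2 = C (c (i + 1)) := by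
        rw [← C_pow, hc, sq]
      rw [hs, hy]
      linear_combination e1 - e2 * blockForm n k i + e3 * blockForm n k i ^ 2
    rw [Fintype.sum_sum_type]
    simp only [zero_mul, Finset.sum_const_zero, zero_add]
    rw [← Finset.sum_add_distrib]
    refine Eq.trans ?_ (Finset.sum_congr rfl fun i _ => (hterm i).symm)
    rw [Finset.sum_add_distrib, Fin.sum_univ_eq_sum_range
      (fun i => C (c (i + 1)) * y (i + 1) - C (c i) * y i) m,
      Finset.sum_range_sub fun i => C (c i) * y i]
    have hy0 : y 0 = blockForm n k 0 := if_pos hm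
    have hym : y m = 0 := if_neg (lt_irrefl m)
    have hconst : ∑ _i : Fin m, (C (1 / (32 * m) : ℝ) : MvPolynomial (Fin n) ℝ) = C (1 / 32) := by
      rw [← map_sum]
      congr 1
      simp
      field_simp
    rw [hconst, hy0, hym]
    simp [c]
    ring

theorem squaringCertificate_degreeLE {n m k : ℕ} (hm : 1 ≤ m) (hk : 1 ≤ k)
    (hn : 2 * k * m ≤ n) : (squaringCertificate n m k hm).DegreeLE 2 := by
  constructor
  · intro i
    have h1 : ((squaringCertificate n m k hm).h i).totalDegree ≤ 1 := by
      refine (totalDegree_sub _ _).trans (max_le ((totalDegree_C _).trans_le zero_le_one) ?_)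
      refine (totalDegree_mul _ _).trans ?_
      rw [totalDegree_C, zero_add]
      exact totalDegree_blockForm_le _ _ _
    exact (totalDegree_pow _ _).trans (by omega)
  · rintro (j | i)
    · simp [squaringCertificate]
    · refine (totalDegree_mul _ _).trans ?_
      rw [totalDegree_squaringSystem hk hn]
      change (- C ((8 * m : ℝ) ^ (2 ^ (i.val + 1) - 1)) : MvPolynomial (Fin n) ℝ).totalDegree + 2 ≤ 2
      rw [totalDegree_neg, totalDegree_C]

theorem squaringCertificate_coeffLE {n m k : ℕ} (hm : 1 ≤ m) (hk : 1 ≤ k)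
    (hn : 2 * k * m ≤ n) :
    (squaringCertificate n m k hm).CoeffLE ((1 + 3 * k) * (8 * m) ^ 2 ^ m) := by
  have hm1 : (1 : ℝ) ≤ m := by exact_mod_cast hm
  have hk1 : (1 : ℝ) ≤ k := by exact_mod_cast hk
  have hG : (1 : ℝ) ≤ 8 * m := by linarith
  have hu1 : 1 ≤ √(8 * m : ℝ) := Real.one_le_sqrt.2 hG
  have huG : √(8 * m : ℝ) ≤ 8 * m := by
    rw [Real.sqrt_le_left (by linarith)]
    nlinarith
  have hmono : ∀ e ≤ 2 ^ m, (8 * m : ℝ) ^ e ≤ (8 * m) ^ 2 ^ m := fun e he =>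
    pow_le_pow_right₀ hG he
  have hP : (1 : ℝ) ≤ (8 * m) ^ 2 ^ m := one_le_pow₀ hG
  have hPle : (8 * m : ℝ) ^ 2 ^ m ≤ (1 + 3 * k) * (8 * m) ^ 2 ^ m := by nlinarith
  have habsC : ∀ (a : ℝ) (M : Fin n →₀ ℕ), |coeff M (C a : MvPolynomial (Fin n) ℝ)| ≤ |a| := by
    intro a M
    rw [coeff_C]
    split_ifs <;> simp
  constructor
  · intro i M
    have hb := abs_coeff_blockForm_le hk hn i.2 M
    have hβ : (8 * m : ℝ) ^ (2 ^ i.val - 1) * √(8 * m) ≤ (8 * m) ^ 2 ^ m := by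
      refine (mul_le_mul_of_nonneg_left huG (by positivity)).trans ?_
      rw [← pow_succ]
      refine hmono _ ?_
      rw [Nat.sub_add_cancel Nat.one_le_two_pow]
      exact Nat.pow_le_pow_right two_pos i.2.le
    have hα : |1 / (2 * √(8 * m : ℝ))| ≤ 1 := by
      rw [abs_of_nonneg (by positivity), div_le_one (by positivity)]
      linarith
    change |coeff M (C (1 / (2 * √(8 * m))) -
      C ((8 * m : ℝ) ^ (2 ^ i.val - 1) * √(8 * m)) * blockForm n k i)| ≤ _
    rw [coeff_sub, coeff_C_mul]
    refine (abs_sub _ _).trans ?_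
    rw [abs_mul, abs_of_nonneg (a := (8 * m : ℝ) ^ (2 ^ i.val - 1) * √(8 * m)) (by positivity)]
    have := mul_le_mul hβ hb (abs_nonneg _) (by positivity)
    have := (habsC (1 / (2 * √(8 * m))) M).trans hα
    linarith
  · rintro (j | i) M
    · simp only [squaringCertificate, coeff_zero, abs_zero]
      positivity
    · change |coeff M (- C ((8 * m : ℝ) ^ (2 ^ (i.val + 1) - 1)))| ≤ _
      rw [coeff_neg, abs_neg]
      refine (habsC _ M).trans ?_
      rw [abs_of_nonneg (by positivity)]
      refine (hmono _ ?_).trans hPle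
      exact (Nat.sub_le _ _).trans (Nat.pow_le_pow_right two_pos i.2)

theorem natCast_bound_le_double_exp (m k : ℕ) :
    (1 + 3 * k) * (8 * m) ^ 2 ^ m ≤ 2 ^ 2 ^ (k + 2 * m + 5) := by
  have h1 : 1 + 3 * k ≤ 2 ^ (k + 2) := by
    have := Nat.lt_two_pow_self (n := k)
    rw [pow_add]
    omega
  have h2 : 8 * m ≤ 2 ^ (m + 3) := by
    have := Nat.lt_two_pow_self (n := m)
    rw [pow_add]
    omega
  have h3 : k + 2 + (m + 3) * 2 ^ m ≤ 2 ^ (k + 2 * m + 5) := by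
    have a1 := (Nat.lt_two_pow_self (n := k + 2)).le
    have a2 := Nat.mul_le_mul_right (2 ^ m) (Nat.lt_two_pow_self (n := m + 3)).le
    rw [← pow_add] at a2
    have a3 : 2 ^ (k + 2 * m + 5) = 2 ^ (k + 2) * 2 ^ (m + 3 + m) := by
      rw [← pow_add]; congr 1; ring
    have b1 : 2 ≤ 2 ^ (k + 2) := Nat.le_self_pow (by omega) 2
    have b2 : 2 ≤ 2 ^ (m + 3 + m) := Nat.le_self_pow (by omega) 2
    rw [a3]
    nlinarith
  calc (1 + 3 * k) * (8 * m) ^ 2 ^ m ≤ 2 ^ (k + 2) * (2 ^ (m + 3)) ^ 2 ^ m :=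
        Nat.mul_le_mul h1 (Nat.pow_le_pow_left h2 _)
    _ = 2 ^ (k + 2 + (m + 3) * 2 ^ m) := by rw [← pow_mul, ← pow_add]
    _ ≤ _ := Nat.pow_le_pow_right two_pos h3

theorem SoSCertificate.CoeffLE.mono {σ ι : Type*} [Fintype ι] {P : ι → MvPolynomial σ ℝ}
    {r : MvPolynomial σ ℝ} {c : SoSCertificate P r} {B B' : ℝ} (h : c.CoeffLE B) (hB : B ≤ B') :
    c.CoeffLE B' :=
  ⟨fun i M => (h.1 i M).trans hB, fun s M => (h.2 s M).trans hB⟩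

/-! ### Lower bound on the coefficients of every certificate -/

/-- Applying the pseudo-expectation to a certificate: the multiplier of the last equation has a
pseudo-expectation of absolute value at least `(δ - ε) / δ ^ (2 ^ m)`. -/
theorem exists_pseudoExp_mult_ge {n m k d : ℕ} (hm : 1 ≤ m) (hk : 1 ≤ k) (hn : 2 * k * m ≤ n)
    (hd : d ≤ 2 * k) {ε δ : ℝ} (hδ0 : 0 ≤ δ) (hδ1 : δ ≤ 1)
    (cert : SoSCertificate (squaringSystem n m k) (C ε - blockForm n k 0))
    (hcert : cert.DegreeLE d) :
    ∃ s, (cert.mult s).totalDegree ≤ d ∧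
      δ - ε ≤ δ ^ 2 ^ m * |pseudoExp n m k (fun i => δ ^ 2 ^ i) (cert.mult s)| := by
  set η : ℕ → ℝ := fun i => δ ^ 2 ^ i with hη
  have hη0 : ∀ i, 0 ≤ η i := fun i => pow_nonneg hδ0 _
  have hη1 : ∀ i, η i ≤ 1 := fun i => pow_le_one₀ hδ0 hδ1
  have hηsucc : ∀ i, η i * η i = η (i + 1) := fun i => by
    simp only [hη]
    rw [← pow_add, pow_succ, mul_two]
  set E := pseudoExp n m k η with hE
  -- Each equation has degree exactly 2 and degrees add in a domain, so a nonzero multiplier leaves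
  -- room for two factors `yᵢ` within degree `2k`.
  have hmul : ∀ s, cert.mult s = 0 ∨ (cert.mult s).totalDegree + 2 ≤ d := by
    intro s
    by_cases h0 : cert.mult s = 0
    · exact Or.inl h0
    right
    have hdeg := totalDegree_squaringSystem hk hn s
    have hP : squaringSystem n m k s ≠ 0 := by
      intro h
      simp [h] at hdeg
    have := hcert.2 s
    rwa [totalDegree_mul_of_isDomain h0 hP, hdeg] at this
  have hlin : ∀ (i : ℕ) (p : MvPolynomial (Fin n) ℝ), i < m → p.totalDegree < 2 * k →
      E (p * blockForm n k i) = η i * E p := fun i p hi hp => pseudoExp_mul_blockForm hk hn hi hp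
  have hsq : ∀ (i : ℕ) (p : MvPolynomial (Fin n) ℝ), i < m → p = 0 ∨ p.totalDegree + 2 ≤ d →
      E (p * blockForm n k i ^ 2) = η (i + 1) * E p := by
    rintro i p hi (rfl | hp)
    · simp
    · have h1 : (p * blockForm n k i).totalDegree < 2 * k := by
        have := totalDegree_mul p (blockForm n k i)
        have := totalDegree_blockForm_le n k i
        omega
      rw [sq, ← mul_assoc, hlin _ _ hi h1, hlin _ _ hi (by omega), ← mul_assoc, hηsucc]
  let l : Fin m := ⟨m - 1, by omega⟩
  have hlast : E (cert.mult (Sum.inr l) * squaringSystem n m k (Sum.inr l)) =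
      δ ^ 2 ^ m * E (cert.mult (Sum.inr l)) := by
    have hl : ¬((l : ℕ) + 1 < m) := by simp only [l]; omega
    have hl' : (l : ℕ) + 1 = m := by simp only [l]; omega
    rw [squaringSystem, if_neg hl, hsq _ _ l.2 (hmul _), hl']
  have hother : ∀ i : Fin m, i ≠ l →
      E (cert.mult (Sum.inr i) * squaringSystem n m k (Sum.inr i)) = 0 := by
    intro i hi
    have hi' : (i : ℕ) + 1 < m := by
      have h1 : (i : ℕ) ≠ m - 1 := fun h => hi (Fin.ext h)
      have := i.2
      omega
    rw [squaringSystem, if_pos hi', mul_sub, map_sub, hsq _ _ i.2 (hmul _)]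
    rcases hmul (Sum.inr i) with h0 | h0
    · simp [h0]
    · rw [hlin _ _ hi' (by omega), sub_self]
  have hleft : E (C ε - blockForm n k 0) = ε - δ := by
    have h1 := hlin 0 1 hm (by rw [totalDegree_one]; omega)
    have h2 : E 1 = 1 := pseudoExp_one
    have h3 : (C ε : MvPolynomial (Fin n) ℝ) = ε • 1 := by rw [smul_eq_C_mul, mul_one]
    rw [one_mul, h2] at h1
    rw [map_sub, h1, h3, map_smul, h2]
    simp [hη]
  have hsquares : 0 ≤ ∑ i, E (cert.h i ^ 2) := by
    refine Finset.sum_nonneg fun i _ => pseudoExp_sq_nonneg hk hn hη0 hη1 ?_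
    by_cases h0 : cert.h i = 0
    · simp [h0]
    · have := hcert.1 i
      rw [sq, totalDegree_mul_of_isDomain h0 h0] at this
      omega
  have hboolean : ∑ j : Fin n, E (cert.mult (Sum.inl j) * squaringSystem n m k (Sum.inl j)) = 0 :=
    Finset.sum_eq_zero fun j _ => pseudoExp_mul_boolean (cert.mult (Sum.inl j)) j
  have hid := congrArg E cert.identity
  rw [hleft, map_add, map_sum, map_sum, Fintype.sum_sum_type, hboolean, zero_add,
    Finset.sum_eq_single l (fun i _ hi => hother i hi) (by simp), hlast] at hid
  refine ⟨Sum.inr l, ?_, ?_⟩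
  · rcases hmul (Sum.inr l) with h0 | h0
    · simp [h0]
    · omega
  · have := mul_le_mul_of_nonneg_left (neg_abs_le (E (cert.mult (Sum.inr l))))
      (pow_nonneg hδ0 (2 ^ m))
    linarith

theorem abs_pseudoExp_le {n m k d : ℕ} {η : ℕ → ℝ} (hk : 1 ≤ k) (hn : 2 * k * m ≤ n)
    (hη0 : ∀ i, 0 ≤ η i) (hη1 : ∀ i, η i ≤ 1) {p : MvPolynomial (Fin n) ℝ}
    (hp : p.totalDegree ≤ d) {B : ℝ} (hB : ∀ M, |coeff M p| ≤ B) :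
    |pseudoExp n m k η p| ≤ (n + 1) ^ d * B := by
  have hB0 : 0 ≤ B := (abs_nonneg _).trans (hB 0)
  rw [pseudoExp_eq_sum]
  refine (Finset.abs_sum_le_sum_abs _ _).trans ?_
  refine (Finset.sum_le_card_nsmul _ _ B fun M _ => ?_).trans ?_
  · rw [abs_mul]
    exact (mul_le_of_le_one_right (abs_nonneg _)
      (abs_blockMoment_le_one hk hn hη0 hη1 _)).trans (hB M)
  · rw [nsmul_eq_mul]
    refine mul_le_mul_of_nonneg_right ?_ hB0
    exact_mod_cast card_support_le hp

/-- For `d ≤ n` the quotient `(1 + 1/n) ^ d` is at most `e < 3`. -/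
theorem natCast_succ_pow_le {n d : ℕ} (hn : 1 ≤ n) (hd : d ≤ n) :
    ((n : ℝ) + 1) ^ d ≤ 3 * (n : ℝ) ^ d := by
  have hn0 : (0 : ℝ) < n := by exact_mod_cast hn
  have h1 : (n : ℝ) + 1 = n * (1 + 1 / n) := by field_simp
  rw [h1, mul_pow, mul_comm]
  refine mul_le_mul_of_nonneg_right ?_ (by positivity)
  calc (1 + 1 / (n : ℝ)) ^ d ≤ (1 + 1 / (n : ℝ)) ^ n :=
        pow_le_pow_right₀ (by simp) hd
    _ ≤ Real.exp (1 / n) ^ n := by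
        gcongr
        rw [add_comm]
        exact Real.add_one_le_exp _
    _ = Real.exp 1 := by
        rw [← Real.exp_nat_mul]
        congr 1
        field_simp
    _ ≤ 3 := by linarith [Real.exp_one_lt_d9]

theorem theorem1p2 :
    ∃ ε c A : ℝ, 0 < ε ∧ ε < 1 / 2 ∧ 0 < c ∧
      ∀ n : ℕ, 2 ≤ n → ∃ m k : ℕ, 1 ≤ m ∧ 1 ≤ k ∧ 2 * k * m ≤ n ∧
        (∀ s, (squaringSystem n m k s).totalDegree = 2) ∧
        (∀ j : Fin n, ∃ s, squaringSystem n m k s = X j ^ 2 - X j) ∧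
        (∃ cert : SoSCertificate (squaringSystem n m k) (C ε - blockForm n k 0),
          cert.DegreeLE 2 ∧ cert.CoeffLE ((2 : ℝ) ^ ((2 : ℝ) ^ (A * √(n : ℝ))))) ∧
        (∀ d : ℕ, (d : ℝ) ≤ √(n : ℝ) →
          ∀ cert : SoSCertificate (squaringSystem n m k) (C ε - blockForm n k 0),
            cert.DegreeLE d →
              ∃ s M, c * ((2 : ℝ) ^ ((2 : ℝ) ^ √(n : ℝ)) / (n : ℝ) ^ d)
                ≤ |coeff M (cert.mult s)|) := by
  -- With `δ = 1/16` below, `δ - ε = 1/32 = 4/128`, which beats the `3/128` left after the factor 3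
  -- from `natCast_succ_pow_le`. The 14 bounds `k + 2m + 5 ≤ q + 8q + 5q`.
  refine ⟨1 / 32, 1 / 128, 14, by norm_num, by norm_num, by norm_num, fun n hn2 => ?_⟩
  set q := Nat.sqrt n with hq
  have hqn : q * q ≤ n := Nat.sqrt_le n
  have hnq : n < (q + 1) * (q + 1) := Nat.lt_succ_sqrt n
  have hq1 : 1 ≤ q := Nat.sqrt_pos.2 (by omega)
  have hqsqrt : (q : ℝ) ≤ √n := Real.nat_sqrt_le_real_sqrt
  have hsqrtq : √(n : ℝ) ≤ q + 1 := Real.real_sqrt_le_nat_sqrt_succ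
  -- The block size `2k` is `q` or `q + 1`: large enough for every degree `d ≤ √n`, and small enough
  -- to fit at least `q - 1` blocks.
  obtain ⟨k, hk⟩ : ∃ k, k = (q + 1) / 2 := ⟨_, rfl⟩
  obtain ⟨m, hm⟩ : ∃ m, m = n / (2 * k) := ⟨_, rfl⟩
  have hk1 : 1 ≤ k := by omega
  have hkq : k ≤ q := by omega
  have h2k : q ≤ 2 * k := by omega
  have h2k' : 2 * k ≤ q + 1 := by omega
  have hm1 : 1 ≤ m := by
    rw [hm, Nat.le_div_iff_mul_le (by omega), one_mul]
    rcases hq1.eq_or_lt with h | h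
    · omega
    · nlinarith
  have hmn : 2 * k * m ≤ n := by
    rw [hm]
    exact Nat.mul_div_le _ _
  have hqm : q ≤ m + 1 := by
    have : q - 1 ≤ m := by
      rw [hm, Nat.le_div_iff_mul_le (by omega)]
      obtain ⟨p, hp⟩ : ∃ p, q = p + 1 := ⟨q - 1, by omega⟩
      rw [hp] at hqn h2k' ⊢
      rw [Nat.add_sub_cancel]
      nlinarith
    omega
  have hmq : m ≤ 4 * q := by
    by_contra h
    nlinarith
  refine ⟨m, k, hm1, hk1, hmn, totalDegree_squaringSystem hk1 hmn, fun j => ⟨Sum.inl j, rfl⟩,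
    ⟨squaringCertificate n m k hm1, squaringCertificate_degreeLE hm1 hk1 hmn,
      (squaringCertificate_coeffLE hm1 hk1 hmn).mono ?_⟩, ?_⟩
  · have h1 : ((1 + 3 * k) * (8 * m) ^ 2 ^ m : ℝ) ≤ 2 ^ 2 ^ (k + 2 * m + 5) := by
      exact_mod_cast natCast_bound_le_double_exp m k
    refine h1.trans ?_
    rw [← Real.rpow_natCast]
    refine Real.rpow_le_rpow_of_exponent_le one_le_two ?_
    push_cast
    rw [← Real.rpow_natCast]
    refine Real.rpow_le_rpow_of_exponent_le one_le_two ?_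
    have : ((k + 2 * m + 5 : ℕ) : ℝ) ≤ 14 * q := by
      exact_mod_cast (by omega : k + 2 * m + 5 ≤ 14 * q)
    linarith
  · intro d hd cert hcert
    have hdq : d ≤ q := Nat.le_sqrt.2 (by
      have := mul_self_le_mul_self d.cast_nonneg hd
      rw [Real.mul_self_sqrt n.cast_nonneg] at this
      exact_mod_cast this)
    obtain ⟨s, hs, hE⟩ := exists_pseudoExp_mult_ge (ε := 1 / 32) (δ := 1 / 16) hm1 hk1 hmn
      (hdq.trans h2k) (by norm_num) (by norm_num) cert hcert
    set Z : ℝ := (2 : ℝ) ^ ((2 : ℝ) ^ √(n : ℝ)) with hZ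
    have hZ0 : 0 < Z := by positivity
    have hZle : Z ≤ 16 ^ 2 ^ m := by
      -- As `16 = 2 ^ 2 ^ 2`, the base adds 2 to the upper exponent, which makes up for `m ≥ q - 1`
      -- and `√n ≤ q + 1`.
      have h16 : (16 : ℝ) ^ 2 ^ m = 2 ^ 2 ^ (m + 2) := by
        rw [show (16 : ℝ) = 2 ^ 4 by norm_num, ← pow_mul]
        congr 1
        ring
      rw [h16, ← Real.rpow_natCast]
      refine Real.rpow_le_rpow_of_exponent_le one_le_two ?_
      push_cast
      rw [← Real.rpow_natCast]
      refine Real.rpow_le_rpow_of_exponent_le one_le_two ?_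
      have : (q : ℝ) + 1 ≤ (m + 2 : ℕ) := by exact_mod_cast (by omega : q + 1 ≤ m + 2)
      linarith
    have hnd : (0 : ℝ) < (n : ℝ) ^ d := by
      have : (0 : ℝ) < n := by exact_mod_cast (by omega : 0 < n)
      positivity
    refine ⟨s, ?_⟩
    by_contra! hcon
    have habs := abs_pseudoExp_le hk1 hmn (η := fun i => (1 / 16 : ℝ) ^ 2 ^ i)
      (fun i => by positivity) (fun i => pow_le_one₀ (by norm_num) (by norm_num)) hs
      fun M => (hcon M).le
    have hpow := natCast_succ_pow_le (n := n) (d := d) (by omega) (by nlinarith)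
    have hE' : 1 / 32 * 16 ^ 2 ^ m ≤
        |pseudoExp n m k (fun i => (1 / 16 : ℝ) ^ 2 ^ i) (cert.mult s)| := by
      rw [one_div_pow (16 : ℝ), one_div_mul_eq_div, le_div_iff₀ (by positivity)] at hE
      linarith
    have hfin : ((n : ℝ) + 1) ^ d * (1 / 128 * (Z / (n : ℝ) ^ d)) ≤ 3 / 128 * Z := by
      refine (mul_le_mul_of_nonneg_right hpow (by positivity)).trans_eq ?_
      field_simp
    linarith
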